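/- Let $k\ge 2$ and $n\ge 2k-3$ be integers. Consider a collection of (affine) hyperplanes in $\mathbb{R}^n$, in which a hyperplane may occur several times and is then counted with multiplicity, such that every point of $\{0,1\}^n\setminus\{(0,\dots,0)\}$ is covered by at least $k$ of these hyperplanes, but no hyperplane of the collection contains $(0,\dots,0)$. Then the collection consists of at least $n+2k-3$ hyperplanes. -/

import Mathlib

/-- A subset of `ℝⁿ` is an (affine) hyperplane if it is the solution set of a linear equation
`a₁ x₁ + ⋯ + aₙ xₙ = b` with real coefficients, where `a ≠ 0`. -/
def IsHyperplane {n : ℕ} (H : Set (Fin n → ℝ)) : Prop :=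
  ∃ (a : Fin n → ℝ) (b : ℝ), a ≠ 0 ∧ H = {x | ∑ j, a j * x j = b}

/-!
A collection of fewer than `n + 2k - 3` hyperplanes gives a polynomial `P`, the product of their
equations, of degree at most `n + 2k - 4`, which vanishes to order `k` at all vertices of the cube
except the origin, where it does not vanish. The contradiction comes from residues at the vertices.

For an exponent `a`, the sum over the vertices of the residues of `f / ∏ (x_j² - x_j)^(a_j + 1)` is
zero if `deg f < 2|a| + n`: on a monomial it is a product over the variables, and a factor with a
small exponent vanishes (`sum_coeff_expandAt_mul_geomProd_eq_zero`). Take `f = P x_i` and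
`a = b + e_i` with `|b| = k - 2`. By the order of vanishing of `P`, only the residue at the origin is
left, so, with `W_j = 1 / (1 - x_j)` and `Q_b = ∏ W_j^(b_j + 1)`,

`[x^b] P Q_b W_i = 0` for all `b` of degree `k - 2` and all `i`

(`coeff_expandAt_mul_geomProd_mul_geom_eq_zero`).

These equations force `P(0) = 0`, by descent on the degree of `b`
(`constantCoeff_eq_zero_of_coeff_mul_geomProd_eq_zero`). Suppose `[x^b] P Q_b H(W_i) = 0` for all `b`
of degree `d + 1` and all `i`, where `H` is a nonzero polynomial with natural coefficients and
without constant term. As `d + 1 ≤ k - 2 < n`, some variable `x_l` does not occur in `x^b`, and as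
`W_l` is `1` modulo `x_l`, the equation for `i = l` says that `H(1) [x^b] P Q_b = 0`. Subtract this
from the equation for an arbitrary `i`, with `b = c + e_i`. If `H - H(1) = (X - 1) K`, then
`H(W_i) - H(1) = x_i W_i K(W_i)`, so `[x^c] P Q_c W_i² K(W_i) = 0`, the same equation in degree `d`
for the polynomial `X² K`, which again has natural coefficients. In degree zero it reads
`P(0) H(1) = 0`, where `H(1)` is a positive integer.
-/

open Finset

/-! ### Products of power series in separate variables -/

section SeparatedSeries

variable {σ R : Type*} [Fintype σ] [CommRing R]

/-- The power series `∏ j, u j (X j)` in the variables `X j`, given by its coefficients, as a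
multiplicative map in the family `u` of univariate power series. -/
noncomputable def separatedSeries : (σ → PowerSeries R) →* MvPowerSeries σ R where
  toFun u := fun m => ∏ j, PowerSeries.coeff (m j) (u j)
  map_one' := by
    classical
    ext m
    change ∏ j, PowerSeries.coeff (m j) ((1 : σ → PowerSeries R) j) = MvPowerSeries.coeff m 1
    rw [MvPowerSeries.coeff_one]
    simp only [Pi.one_apply, PowerSeries.coeff_one, Finset.prod_ite_zero, Finset.prod_const_one]
    simp [Finsupp.ext_iff]
  map_mul' u v := by
    classical
    ext m
    refine Eq.trans ?_ (MvPowerSeries.coeff_mul m _ _).symm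
    change ∏ j, PowerSeries.coeff (m j) ((u * v) j) = ∑ p ∈ antidiagonal m,
      (∏ j, PowerSeries.coeff (p.1 j) (u j)) * ∏ j, PowerSeries.coeff (p.2 j) (v j)
    simp only [Pi.mul_apply, PowerSeries.coeff_mul]
    rw [Finset.prod_univ_sum]
    refine Finset.sum_bij' (fun q _ => (Finsupp.equivFunOnFinite.symm fun j => (q j).1,
      Finsupp.equivFunOnFinite.symm fun j => (q j).2)) (fun p _ => fun j => (p.1 j, p.2 j))
      ?_ ?_ ?_ ?_ ?_
    · intro q hq
      simp only [Fintype.mem_piFinset, HasAntidiagonal.mem_antidiagonal] at hq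
      simp only [HasAntidiagonal.mem_antidiagonal]
      ext j
      simpa using hq j
    · intro p hp
      simp only [HasAntidiagonal.mem_antidiagonal] at hp
      simp only [Fintype.mem_piFinset, HasAntidiagonal.mem_antidiagonal]
      intro j
      simp [← hp]
    · intro q _
      rfl
    · intro p _
      ext <;> simp
    · intro q _
      simp [Finset.prod_mul_distrib]

lemma coeff_separatedSeries (u : σ → PowerSeries R) (m : σ →₀ ℕ) :
    MvPowerSeries.coeff m (separatedSeries u) = ∏ j, PowerSeries.coeff (m j) (u j) := rfl

variable [DecidableEq σ]

/-- The power series `u (X j)` in several variables. -/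
noncomputable def inVariable (j : σ) : PowerSeries R →* MvPowerSeries σ R :=
  separatedSeries.comp (MonoidHom.mulSingle (fun _ => PowerSeries R) j)

lemma coeff_inVariable (j : σ) (u : PowerSeries R) (m : σ →₀ ℕ) :
    MvPowerSeries.coeff m (inVariable j u) =
      PowerSeries.coeff (m j) u * ∏ i ∈ univ.erase j, if m i = 0 then 1 else 0 := by
  change ∏ i, PowerSeries.coeff (m i) (Pi.mulSingle (M := fun _ => PowerSeries R) j u i) = _
  rw [← Finset.mul_prod_erase _ _ (mem_univ j), Pi.mulSingle_eq_same]
  congr 1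
  refine Finset.prod_congr rfl fun i hi => ?_
  rw [Pi.mulSingle_eq_of_ne (Finset.ne_of_mem_erase hi), PowerSeries.coeff_one]

lemma inVariable_sub (j : σ) (u v : PowerSeries R) :
    inVariable j (u - v) = inVariable j u - inVariable j v := by
  ext m
  simp only [map_sub, coeff_inVariable, sub_mul]

lemma inVariable_X (j : σ) :
    inVariable j (PowerSeries.X : PowerSeries R) = MvPowerSeries.X j := by
  ext m
  have key : (m j = 1 ∧ ∀ i ∈ univ.erase j, m i = 0) ↔ m = Finsupp.single j 1 := by
    rw [Finsupp.ext_iff]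
    constructor
    · rintro ⟨h1, h2⟩ i
      by_cases h : i = j
      · subst h
        simpa using h1
      · rw [Finsupp.single_eq_of_ne h]
        exact h2 i (by simp [h])
    · intro h
      refine ⟨by simpa using h j, fun i hi => ?_⟩
      rw [h i, Finsupp.single_eq_of_ne (Finset.ne_of_mem_erase hi)]
  rw [coeff_inVariable, PowerSeries.coeff_X, MvPowerSeries.coeff_X, Finset.prod_ite_zero,
    ite_zero_mul_ite_zero, Finset.prod_const_one, mul_one]
  by_cases h : m = Finsupp.single j 1
  · rw [if_pos h, if_pos (key.mpr h)]
  · rw [if_neg h, if_neg (fun h' => h (key.mp h'))]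

lemma prod_inVariable (u : σ → PowerSeries R) :
    ∏ j, inVariable j (u j) = separatedSeries u := by
  have h := map_prod (separatedSeries (σ := σ) (R := R)) (fun j => Pi.mulSingle j (u j)) univ
  rw [Finset.univ_prod_mulSingle] at h
  exact h.symm

end SeparatedSeries

/-! ### The residue identity in one variable -/

/-- The geometric series satisfies `[t^a] t^m (1 - t)^{-(a+1)} = [t^a] (1 - t)^m (1 - t)^{-(a+1)}`
for `m ≤ 2a`. Both sides are local contributions to the sum of the residues of the rational
function `x^m / (x^2 - x)^{a+1}`, which has no residue at infinity. -/
lemma coeff_pow_mul_geom_eq {R : Type*} [CommRing R] {a m : ℕ} (hm : m ≤ 2 * a) :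
    PowerSeries.coeff a (PowerSeries.X ^ m * (PowerSeries.mk 1 : PowerSeries R) ^ (a + 1)) =
      PowerSeries.coeff a
        ((1 - PowerSeries.X) ^ m * (PowerSeries.mk 1 : PowerSeries R) ^ (a + 1)) := by
  have hW := PowerSeries.mk_one_mul_one_sub_eq_one R
  rw [PowerSeries.coeff_X_pow_mul']
  rcases le_or_gt m a with h | h
  · obtain ⟨c, rfl⟩ := Nat.exists_eq_add_of_le h
    have : (1 - PowerSeries.X) ^ m * (PowerSeries.mk 1 : PowerSeries R) ^ (m + c + 1) =
        (PowerSeries.mk 1) ^ (c + 1) := by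
      rw [add_assoc, pow_add, ← mul_assoc, ← mul_pow, mul_comm (1 - _), hW, one_pow, one_mul]
    rw [this, if_pos h, PowerSeries.mk_one_pow_eq_mk_choose_add,
      PowerSeries.mk_one_pow_eq_mk_choose_add, PowerSeries.coeff_mk, PowerSeries.coeff_mk,
      Nat.add_sub_cancel_left, show c + (m + c) = m + c + c by ring,
      ← Nat.choose_symm_add (a := m + c) (b := c)]
  · obtain ⟨c, rfl⟩ := Nat.exists_eq_add_of_lt h
    have : (1 - PowerSeries.X) ^ (a + c + 1) * (PowerSeries.mk 1 : PowerSeries R) ^ (a + 1) =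
        (1 - PowerSeries.X) ^ c := by
      rw [show a + c + 1 = c + (a + 1) by ring, pow_add, mul_assoc, ← mul_pow,
        mul_comm (1 - _) (PowerSeries.mk 1), hW, one_pow, mul_one]
    have h2 : ((1 - PowerSeries.X) ^ c : PowerSeries R) =
        (((1 - Polynomial.X) ^ c : Polynomial R) : PowerSeries R) := by simp
    rw [this, if_neg (by omega), h2, Polynomial.coeff_coe, Polynomial.coeff_eq_zero_of_natDegree_lt]
    refine lt_of_le_of_lt (b := c) ?_ (by omega)
    refine (Polynomial.natDegree_pow_le.trans (Nat.mul_le_mul_left c ?_)).trans_eq (mul_one c)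
    exact (Polynomial.natDegree_sub_le _ _).trans (by simpa using Polynomial.natDegree_X_le)

/-! ### Residues at the vertices of the cube -/

section Expansion

variable {σ R : Type*} [CommRing R]

/-- The expansion of a polynomial at a vertex `p` of the cube, in the local coordinates at `p`
that increase into the cube: `1 - x j` if `p j` is true, and `x j` otherwise. -/
noncomputable def expandAt (p : σ → Bool) : MvPolynomial σ R →ₐ[R] MvPowerSeries σ R :=
  MvPolynomial.aeval fun j => if p j then 1 - MvPowerSeries.X j else MvPowerSeries.X j

/-- The constant term of the expansion at a vertex is the value at this vertex. -/
lemma constantCoeff_expandAt (p : σ → Bool) (P : MvPolynomial σ R) :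
    MvPowerSeries.constantCoeff (expandAt p P) =
      MvPolynomial.eval (fun j => if p j then 1 else 0) P := by
  induction P using MvPolynomial.induction_on with
  | C r => simp [expandAt, MvPowerSeries.algebraMap_apply]
  | add f g hf hg => simp [hf, hg]
  | mul_X f j hf =>
    rw [map_mul, map_mul, hf, map_mul, MvPolynomial.eval_X]
    congr 1
    rw [expandAt, MvPolynomial.aeval_X]
    split_ifs <;> simp

end Expansion

section Residue

variable {σ R : Type*} [Fintype σ] [DecidableEq σ] [CommRing R]

/-- The geometric series `1 / (1 - X j)` in the variable `X j`. -/
noncomputable def geom (R : Type*) [CommRing R] (j : σ) : MvPowerSeries σ R :=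
  inVariable j (PowerSeries.mk 1)

lemma inVariable_one_sub_X (j : σ) :
    inVariable j (1 - PowerSeries.X : PowerSeries R) = 1 - MvPowerSeries.X j := by
  rw [inVariable_sub, map_one, inVariable_X]

lemma geom_sub_one (j : σ) : geom R j - 1 = MvPowerSeries.X j * geom R j := by
  have h : geom R j * (1 - MvPowerSeries.X j) = 1 := by
    rw [← inVariable_one_sub_X, geom, ← map_mul, PowerSeries.mk_one_mul_one_sub_eq_one, map_one]
  linear_combination h

/-- The series `∏ j, (1 - X j)^{-(a j + 1)}`, which is, up to sign, the regular factor of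
`∏ j, ((X j)^2 - X j)^{-(a j + 1)}` at the origin. -/
noncomputable def geomProd (R : Type*) [CommRing R] (a : σ →₀ ℕ) : MvPowerSeries σ R :=
  ∏ j, geom R j ^ (a j + 1)

/-- The vanishing of the sum of residues of `f / ∏ j, ((X j)^2 - X j)^{a j + 1}` over the vertices
of the cube, for `f` of small total degree. The sign at `p` comes from `dx j = -dt j` for the local
coordinate `t j = 1 - x j`; the denominator is the same in `x j` and in `1 - x j`. -/
lemma sum_coeff_expandAt_mul_geomProd_eq_zero (f : MvPolynomial σ R) (a : σ →₀ ℕ)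
    (hf : f.totalDegree < 2 * a.degree + Fintype.card σ) :
    ∑ p : σ → Bool, (∏ j, if p j then (-1 : R) else 1) *
      MvPowerSeries.coeff a (expandAt p f * geomProd R a) = 0 := by
  rw [f.as_sum]
  simp only [map_sum, Finset.sum_mul, Finset.mul_sum]
  rw [Finset.sum_comm]
  refine Finset.sum_eq_zero fun m hm => ?_
  -- Some variable occurs in the monomial with a small exponent.
  obtain ⟨j₀, hj₀⟩ : ∃ j, m j ≤ 2 * a j := by
    by_contra! h
    have h1 := (MvPolynomial.le_totalDegree hm).trans_lt hf
    rw [Finsupp.sum_fintype _ _ (fun _ => rfl), Finsupp.degree_eq_sum] at h1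
    have h2 : ∑ j, (2 * a j + 1) ≤ ∑ j, m j := Finset.sum_le_sum fun j _ => h j
    rw [Finset.sum_add_distrib, ← Finset.mul_sum] at h2
    simp at h2
    omega
  let w : σ → Bool → PowerSeries R := fun j b =>
    (if b then 1 - PowerSeries.X else PowerSeries.X) ^ m j * (PowerSeries.mk 1) ^ (a j + 1)
  have key : ∀ p : σ → Bool, expandAt p (MvPolynomial.monomial m (f.coeff m)) * geomProd R a =
      MvPowerSeries.C (f.coeff m) * separatedSeries (fun j => w j (p j)) := by
    intro p
    rw [expandAt, MvPolynomial.aeval_monomial, mul_assoc, ← prod_inVariable,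
      Finsupp.prod_fintype _ _ (fun _ => pow_zero _), geomProd, ← Finset.prod_mul_distrib]
    refine congrArg₂ _ rfl (Finset.prod_congr rfl fun j _ => ?_)
    simp only [w, map_mul, map_pow, geom]
    congr 2
    split_ifs
    · exact (inVariable_one_sub_X j).symm
    · exact (inVariable_X j).symm
  simp only [key, MvPowerSeries.coeff_C_mul, coeff_separatedSeries]
  have h3 : ∏ j, ∑ b : Bool, (if b then (-1 : R) else 1) * PowerSeries.coeff (a j) (w j b) = 0 := by
    refine Finset.prod_eq_zero (mem_univ j₀) ?_
    simp [w, coeff_pow_mul_geom_eq hj₀]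
  rw [Finset.prod_univ_sum, Fintype.piFinset_univ] at h3
  rw [← mul_zero (f.coeff m), ← h3, Finset.mul_sum]
  refine Finset.sum_congr rfl fun p _ => ?_
  rw [Finset.prod_mul_distrib]
  ring

end Residue

/-! ### Descent on the order of the jet at the origin -/

section Descent

variable {σ R : Type*} [Fintype σ] [DecidableEq σ] [CommRing R]

lemma geomProd_add_single (b : σ →₀ ℕ) (i : σ) :
    geomProd R (b + Finsupp.single i 1) = geomProd R b * geom R i := by
  have h : ∏ j, geom R j ^ (Finsupp.single i 1 j) = geom R i := by
    rw [Finset.prod_eq_single i (fun j _ hj => by simp [Finsupp.single_eq_of_ne hj])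
      (fun h => absurd (mem_univ i) h)]
    simp
  rw [geomProd, geomProd, ← h, ← Finset.prod_mul_distrib]
  refine Finset.prod_congr rfl fun j _ => ?_
  rw [← pow_add, Finsupp.add_apply]
  congr 1
  ring

lemma constantCoeff_geom (j : σ) : MvPowerSeries.constantCoeff (geom R j) = 1 := by
  have h := congrArg MvPowerSeries.constantCoeff (geom_sub_one (R := R) j)
  simpa [sub_eq_zero] using h

lemma constantCoeff_geomProd (b : σ →₀ ℕ) :
    MvPowerSeries.constantCoeff (geomProd R b) = 1 := by
  simp [geomProd, constantCoeff_geom]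

/-- Division of `H - H(1)` by `X - 1` gives a quotient with natural coefficients; the identity
`H - H(1) = (X - 1) * K` is rearranged to avoid subtraction. -/
lemma exists_add_eq_C_eval_one_add_X_mul (H : Polynomial ℕ) :
    ∃ K : Polynomial ℕ, H + K = Polynomial.C (H.eval 1) + Polynomial.X * K := by
  induction H using Polynomial.induction_on' with
  | add p q hp hq =>
    obtain ⟨K, hK⟩ := hp
    obtain ⟨L, hL⟩ := hq
    refine ⟨K + L, ?_⟩
    rw [Polynomial.eval_add, map_add, add_add_add_comm, hK, hL]
    ring
  | monomial n a =>
    induction n with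
    | zero => exact ⟨0, by simp⟩
    | succ n ih =>
      obtain ⟨K, hK⟩ := ih
      refine ⟨Polynomial.monomial n a + K, ?_⟩
      rw [← Polynomial.monomial_mul_X]
      simp only [Polynomial.eval_mul, Polynomial.eval_X, mul_one]
      rw [mul_comm, add_comm, hK, add_assoc, ← mul_add, add_comm K, hK]

/-- If the coefficients at all exponents `b` of degree `d` in `Φ * geomProd b * H (1 / (1 - X i))`
vanish, where `H` is a nonzero polynomial with natural coefficients and no constant term, then `Φ`
has no constant term. An exponent of degree `d + 1 < card σ` misses a variable, and the hypothesis
at this variable shows that the contribution of the constant `H(1)` is zero at every variable; what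
remains has a factor `X i` and is the same condition in degree `d`, for the polynomial
`X ^ 2 * (H - H(1)) / (X - 1)`. -/
lemma constantCoeff_eq_zero_of_coeff_mul_geomProd_eq_zero [NoZeroDivisors R] [CharZero R]
    (Φ : MvPowerSeries σ R) (d : ℕ) (hd : d < Fintype.card σ) (H : Polynomial ℕ) (hH : H ≠ 0)
    (hH0 : H.coeff 0 = 0)
    (h : ∀ b : σ →₀ ℕ, b.degree = d → ∀ i, MvPowerSeries.coeff b
      (Φ * geomProd R b * Polynomial.aeval (geom R i) H) = 0) :
    MvPowerSeries.constantCoeff Φ = 0 := by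
  induction d generalizing H with
  | zero =>
    obtain ⟨i⟩ : Nonempty σ := Fintype.card_pos_iff.mp hd
    have h0 := h 0 (by simp) i
    rw [MvPowerSeries.coeff_zero_eq_constantCoeff_apply, map_mul, map_mul, constantCoeff_geomProd,
      mul_one] at h0
    have h1 : MvPowerSeries.constantCoeff (Polynomial.aeval (geom R i) H) =
        ((H.eval 1 : ℕ) : R) := by
      rw [Polynomial.aeval_def, Polynomial.hom_eval₂, constantCoeff_geom,
        Polynomial.eval₂_at_one, eq_natCast]
    rw [h1, mul_eq_zero] at h0
    refine h0.resolve_right fun h2 => hH ?_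
    rw [Nat.cast_eq_zero, Polynomial.eval_eq_sum, Polynomial.sum_def, Finset.sum_eq_zero_iff] at h2
    refine Polynomial.support_eq_empty.mp (Finset.eq_empty_of_forall_notMem fun c hc => ?_)
    exact Polynomial.mem_support_iff.mp hc (by simpa using h2 c hc)
  | succ d ih =>
    obtain ⟨K, hK⟩ := exists_add_eq_C_eval_one_add_X_mul H
    -- This is `H(W) = H(1) + (W - 1) K(W)` for `W = 1 / (1 - X i)`, where `W - 1 = X i * W`.
    have hexp : ∀ i : σ, Polynomial.aeval (geom R i) H = MvPowerSeries.C ((H.eval 1 : ℕ) : R) +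
        MvPowerSeries.X i * (geom R i * Polynomial.aeval (geom R i) K) := by
      intro i
      have h1 := congrArg (Polynomial.aeval (geom R i)) hK
      rw [map_add, map_add, map_mul, Polynomial.aeval_X, Polynomial.aeval_C] at h1
      simp only [eq_natCast, map_natCast] at h1 ⊢
      linear_combination h1 + Polynomial.aeval (geom R i) K * geom_sub_one (R := R) i
    -- Take the hypothesis at a variable missing in `b`, so that only `H(1)` contributes.
    have hzero : ∀ b : σ →₀ ℕ, b.degree = d + 1 →
        ((H.eval 1 : ℕ) : R) * MvPowerSeries.coeff b (Φ * geomProd R b) = 0 := by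
      intro b hb
      obtain ⟨l, hl⟩ : ∃ l, b l = 0 := by
        by_contra! h0
        have h1 : ∑ _j : σ, 1 ≤ ∑ j, b j :=
          Finset.sum_le_sum fun j _ => Nat.one_le_iff_ne_zero.mpr (h0 j)
        rw [← Finsupp.degree_eq_sum, hb] at h1
        simp at h1
        omega
      have h1 := h b hb l
      have h2 : MvPowerSeries.coeff b (MvPowerSeries.X l *
          (Φ * geomProd R b * (geom R l * Polynomial.aeval (geom R l) K))) = 0 :=
        MvPowerSeries.X_dvd_iff.mp (dvd_mul_right _ _) b hl
      rw [hexp, mul_add, mul_left_comm _ (MvPowerSeries.X l), map_add, h2, add_zero, mul_comm,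
        MvPowerSeries.coeff_C_mul] at h1
      exact h1
    refine ih (by omega) (Polynomial.X ^ 2 * K) ?_ (by simp) fun b hb i => ?_
    · refine mul_ne_zero (pow_ne_zero _ Polynomial.X_ne_zero) ?_
      -- If `K` were zero, `H` would be a constant without constant term.
      rintro rfl
      rw [mul_zero, add_zero, add_zero] at hK
      rw [hK, Polynomial.coeff_C_zero] at hH0
      rw [hH0, map_zero] at hK
      exact hH hK
    · have hdeg : (b + Finsupp.single i 1).degree = d + 1 := by
        rw [map_add, hb, Finsupp.degree_single]
      have h1 := h _ hdeg i
      have h2 := hzero _ hdeg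
      rw [hexp, mul_add, mul_left_comm _ (MvPowerSeries.X i), map_add, mul_comm (Φ * _),
        MvPowerSeries.coeff_C_mul, h2, zero_add, add_comm b, MvPowerSeries.X,
        MvPowerSeries.coeff_add_monomial_mul, one_mul, add_comm, geomProd_add_single] at h1
      rw [← h1, map_mul (Polynomial.aeval _), map_pow, Polynomial.aeval_X]
      congr 1
      ring

end Descent

/-! ### Degree bound -/

section Vanishing

variable {σ R : Type*} [Fintype σ] [DecidableEq σ] [CommRing R]

/-- If a polynomial of small degree vanishes to order `d + 2` at all vertices of the cube other than
the origin, then the sum of residues reduces to the contribution of the origin. -/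
lemma coeff_expandAt_mul_geomProd_mul_geom_eq_zero (P : MvPolynomial σ R) (d : ℕ)
    (hdeg : P.totalDegree < 2 * d + 1 + Fintype.card σ)
    (hord : ∀ p : σ → Bool, p ≠ (fun _ => false) → ((d + 2 : ℕ) : ℕ∞) ≤ (expandAt p P).order)
    (b : σ →₀ ℕ) (hb : b.degree = d) (i : σ) :
    MvPowerSeries.coeff b (expandAt (fun _ => false) P * geomProd R b * geom R i) = 0 := by
  have ha : (b + Finsupp.single i 1).degree = d + 1 := by
    rw [map_add, hb, Finsupp.degree_single]
  have hres := sum_coeff_expandAt_mul_geomProd_eq_zero (P * MvPolynomial.X i)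
    (b + Finsupp.single i 1) (by
      rw [ha]
      rcases subsingleton_or_nontrivial R with _ | _
      · rw [Subsingleton.elim (P * MvPolynomial.X i) 0, MvPolynomial.totalDegree_zero]
        omega
      · refine (MvPolynomial.totalDegree_mul _ _).trans_lt ?_
        rw [MvPolynomial.totalDegree_X]
        omega)
  rw [Finset.sum_eq_single (fun _ => false)] at hres
  · simp only [Bool.false_eq_true, if_false, Finset.prod_const_one, one_mul, map_mul] at hres
    have hX : expandAt (fun _ => false) (MvPolynomial.X i : MvPolynomial σ R) =
        MvPowerSeries.X i := by
      simp [expandAt]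
    rw [hX, geomProd_add_single, mul_comm (expandAt _ P), mul_assoc, add_comm b, MvPowerSeries.X,
      MvPowerSeries.coeff_add_monomial_mul, one_mul, ← mul_assoc] at hres
    exact hres
  · intro p _ hp
    rw [map_mul (expandAt p), mul_assoc, MvPowerSeries.coeff_of_lt_order, mul_zero]
    refine lt_of_lt_of_le ?_ MvPowerSeries.le_order_mul
    rw [ha]
    refine lt_of_lt_of_le (lt_of_lt_of_le ?_ (hord p hp)) le_self_add
    exact_mod_cast Nat.lt_succ_self _
  · simp

/-- A polynomial which vanishes to order `d + 2` at all vertices of the cube other than the origin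
and does not vanish at the origin has degree at least `card σ + 2 * d + 1`. -/
theorem card_add_le_totalDegree [NoZeroDivisors R] [CharZero R] (P : MvPolynomial σ R) (d : ℕ)
    (hd : d < Fintype.card σ)
    (hord : ∀ p : σ → Bool, p ≠ (fun _ => false) → ((d + 2 : ℕ) : ℕ∞) ≤ (expandAt p P).order)
    (h0 : MvPowerSeries.constantCoeff (expandAt (fun _ => false) P) ≠ 0) :
    2 * d + 1 + Fintype.card σ ≤ P.totalDegree := by
  by_contra! hdeg
  refine h0 (constantCoeff_eq_zero_of_coeff_mul_geomProd_eq_zero _ d hd Polynomial.X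
    Polynomial.X_ne_zero Polynomial.coeff_X_zero fun b hb i => ?_)
  rw [Polynomial.aeval_X]
  exact coeff_expandAt_mul_geomProd_mul_geom_eq_zero P d hdeg hord b hb i

end Vanishing

/-! ### Hyperplanes -/

/-- The collection of hyperplanes is an indexed family `H : ι → Set ℝⁿ`, so repetitions are allowed
and counted, and `ι` may be infinite; sizes are counted in `ℕ∞`. -/
theorem mainTheorem4 (k n : ℕ) (hk : 2 ≤ k) (hn : 2 * k - 3 ≤ n)
    {ι : Type*} (H : ι → Set (Fin n → ℝ))
    (hH : ∀ i, IsHyperplane (H i))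
    (hcover : ∀ p : Fin n → ℝ, (∀ j, p j = 0 ∨ p j = 1) → p ≠ 0 →
      (k : ℕ∞) ≤ {i | p ∈ H i}.encard)
    (horigin : ∀ i, (0 : Fin n → ℝ) ∉ H i) :
    ((n + 2 * k - 3 : ℕ) : ℕ∞) ≤ ENat.card ι := by
  classical
  rcases finite_or_infinite ι with _ | _
  swap
  · simp
  have := Fintype.ofFinite ι
  choose a b _ hab using hH
  let ℓ : ι → MvPolynomial (Fin n) ℝ := fun i =>
    ∑ j, MvPolynomial.C (a i j) * MvPolynomial.X j - MvPolynomial.C (b i)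
  have heval : ∀ i x, MvPolynomial.eval x (ℓ i) = 0 ↔ x ∈ H i := by
    intro i x
    rw [hab i]
    simp [ℓ, sub_eq_zero]
  have hdegℓ : ∀ i, (ℓ i).totalDegree ≤ 1 := by
    intro i
    refine (MvPolynomial.totalDegree_sub_C_le _ _).trans
      (MvPolynomial.totalDegree_finsetSum_le fun j _ => ?_)
    refine (MvPolynomial.totalDegree_mul _ _).trans ?_
    simp
  have hdeg : (∏ i, ℓ i).totalDegree ≤ Fintype.card ι := by
    refine (MvPolynomial.totalDegree_finsetProd _ _).trans ?_
    refine (Finset.sum_le_sum fun i _ => hdegℓ i).trans_eq ?_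
    simp
  -- The order `k` is `(k - 2) + 2`, and `2 * k - 3 ≤ n` with `2 ≤ k` gives `k - 2 < n`.
  have main := card_add_le_totalDegree (∏ i, ℓ i) (k - 2) (by simp; omega) ?_ ?_
  · rw [ENat.card_eq_coe_fintype_card, Nat.cast_le]
    rw [Fintype.card_fin] at main
    omega
  · intro p hp
    rw [map_prod]
    refine le_trans ?_ (MvPowerSeries.le_order_prod _ _)
    -- Each hyperplane through the vertex contributes a factor of order at least one.
    have hcov := hcover (fun j => if p j then 1 else 0) (fun j => by cases p j <;> simp) ?_
    · rw [Nat.sub_add_cancel hk]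
      refine hcov.trans ?_
      rw [← Set.coe_toFinset {i | _ ∈ H i}, Set.encard_coe_eq_coe_finsetCard, Finset.card_eq_sum_ones,
        Nat.cast_sum]
      refine (Finset.sum_le_sum fun i hi => ?_).trans
        (Finset.sum_le_sum_of_subset (Finset.subset_univ _))
      rw [Nat.cast_one, MvPowerSeries.one_le_order_iff_constCoeff_eq_zero, constantCoeff_expandAt,
        heval]
      simpa using hi
    · contrapose! hp
      funext j
      have := congrFun hp j
      simpa using this
  · rw [constantCoeff_expandAt, map_prod]
    refine Finset.prod_ne_zero_iff.mpr fun i _ h => horigin i ?_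
    rw [heval] at h
    simp only [Bool.false_eq_true, if_false] at h
    exact h
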